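/- Setting. Let $X$ be a finite data set with a symmetric similarity function $S:X\times X\to\mathbb R$, and for non-empty $A,B\subseteq X$ let $S(A,B)$ be the average of $S(x,y)$ over $x\in A$, $y\in B$. A clustering is a partition of $X$ into non-empty clusters. A clustering satisfies stability if for any two different clusters $C,D$ of it, every non-empty $A\subsetneq C$ and every non-empty $B\subseteq D$, $S(A,C\setminus A)>S(A,B)$. For a set $A$ and a clustering $\mathcal P$ put $\mathrm{dist}(A,\mathcal P)=|\{B\in\mathcal P: B\cap A\neq\emptyset\}|-1$, and $\mathrm{dist}(\mathcal Q,\mathcal P)=\sum_{A\in\mathcal Q}\mathrm{dist}(A,\mathcal P)$. Let $\mathcal C^*$ be the target clustering, with $k$ clusters, and $\mathcal C$ the initial clustering; its overclustering error is $\delta_o=\mathrm{dist}(\mathcal C,\mathcal C^*)$ and its underclustering error is $\delta_u=\mathrm{dist}(\mathcal C^*,\mathcal C)$. Algorithms. Let $T$ be an average-linkage tree of $X$: starting from the single points, two distinct current nodes $N_1,N_2$ with the largest $S(N_1,N_2)$ are joined repeatedly (ties broken arbitrarily) until one node is left. $\mathrm{Split}(C)$ finds the node of $T$, with children $N_1,N_2$,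 at which the points of $C$ are first split in two, and returns $N_1\cap C$ and $N_2\cap C$. A request to split a cluster $C$ is answered by replacing $C$ by the two parts $\mathrm{Split}(C)$. A request to merge clusters $C_i,C_j$ is answered by computing $\mathrm{Split}(C_i\cup C_j)=\{C_i',C_j'\}$ and replacing $C_i,C_j$ by $C_i\cup C_j$ if $\{C_i',C_j'\}=\{C_i,C_j\}$, and by $C_i',C_j'$ otherwise. Oracle (unrestricted-merge model with random merges). Starting from $\mathcal C$, as long as the current clustering is not $\mathcal C^*$, an oracle makes a request, possibly at random and depending on the whole history. It may request to split any cluster that contains points from two or more target clusters. A pair of distinct current clusters is a feasible merge if both contain a point of the same target cluster; conditionally on the history and on the next request being a merge request, that request is uniformly distributed over the feasible merges. The choice between a split and a merge request, and the choice of the split, are otherwise arbitrary. Theorem. There is an absolute constant $K>0$ such that the following holds. If $\mathcal C^*$ satisfies stability with respect to $S$, $0<\varepsilon<1$ and $k/\varepsilon\ge 2$, then for every such oracle, with probability at least $1-\varepsilon$ the clustering becomes $\mathcal C^*$ after at most $\delta_o$ split requests and at most $K\,\log(k/\varepsilon)\,\delta_u^2$ merge requests. -/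

import Mathlib

namespace InteractiveClustering

/-! A clustering of a finite data set `X` is a `Finpartition (Finset.univ : Finset X)`. The clusterings
that arise during the interaction are handled through their sets of clusters, of type
`Finset (Finset X)`. -/

section Basic

variable {X : Type*} [DecidableEq X]

/-- The average similarity `S(A, B)` of two finite sets of points. -/
noncomputable def avgSim (S : X → X → ℝ) (A B : Finset X) : ℝ :=
  (∑ x ∈ A, ∑ y ∈ B, S x y) / ((A.card : ℝ) * (B.card : ℝ))

/-- Stability of a clustering `P` with respect to the similarity function `S`: a non-empty proper
part `A` of a cluster `C` is on average more similar to the rest of `C` than to any non-empty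
part `B` of another cluster `D`. -/
def Stable (S : X → X → ℝ) (P : Finset (Finset X)) : Prop :=
  ∀ C ∈ P, ∀ D ∈ P, C ≠ D → ∀ A B : Finset X, A.Nonempty → A ⊂ C → B.Nonempty → B ⊆ D →
    avgSim S A B < avgSim S A (C \ A)

/-- `dist(A, P)`: the number of additional clusters of `P` that contain points of `A`. -/
def clusterDist (A : Finset X) (P : Finset (Finset X)) : ℕ :=
  (P.filter fun B => (B ∩ A).Nonempty).card - 1

/-- `dist(P, Q) = ∑_{A ∈ P} dist(A, Q)`. -/
def clusteringDist (P Q : Finset (Finset X)) : ℕ :=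
  ∑ A ∈ P, clusterDist A Q

/-- The overclustering error of the proposed clustering `P` for the target clustering. -/
def overclusteringError (P target : Finset (Finset X)) : ℕ :=
  clusteringDist P target

/-- The underclustering error of the proposed clustering `P` for the target clustering. -/
def underclusteringError (P target : Finset (Finset X)) : ℕ :=
  clusteringDist target P

end Basic

/-! ### The average-linkage tree -/

/-- Binary trees whose leaves are data points. -/
inductive LinkageTree (X : Type*) where
  | leaf (x : X) : LinkageTree X
  | node (l r : LinkageTree X) : LinkageTree X

section Tree

variable {X : Type*} [DecidableEq X]

/-- The points at the leaves below (the root of) a tree. -/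
def LinkageTree.points : LinkageTree X → Finset X
  | .leaf x => {x}
  | .node l r => l.points ∪ r.points

/-- One step of bottom-up average linkage on the set `F` of current (parentless) nodes: two distinct
current nodes whose average similarity is the largest one are merged, ties being broken
arbitrarily. -/
def LinkageStep (S : X → X → ℝ) (F F' : Set (LinkageTree X)) : Prop :=
  ∃ a ∈ F, ∃ b ∈ F, a ≠ b ∧
    (∀ c ∈ F, ∀ d ∈ F, c ≠ d → avgSim S c.points d.points ≤ avgSim S a.points b.points) ∧
    F' = insert (LinkageTree.node a b) (F \ {a, b})

/-- `T` is an average-linkage tree of the data set `X`: it is what is left when linkage steps,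
starting from the single points, have merged everything. -/
def IsAverageLinkageTree (S : X → X → ℝ) (T : LinkageTree X) : Prop :=
  Relation.ReflTransGen (LinkageStep S) (Set.range LinkageTree.leaf) {T}

/-- The split procedure: follow the points of `C` down the tree to the node at which they are first
split in two, and return the parts of `C` in its two children. (A set of at least two points of the
tree never ends up in a leaf.) -/
def LinkageTree.split : LinkageTree X → Finset X → Finset X × Finset X
  | .leaf _, C => (C, ∅)
  | .node l r, C =>
      if C ⊆ l.points then l.split C
      else if C ⊆ r.points then r.split C
      else (l.points ∩ C, r.points ∩ C)

end Tree

/-! ### Requests, their feasibility, and the algorithm's answers -/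

/-- An edit request: to split a cluster, or to merge the two clusters that form the (unordered)
pair `q`. -/
inductive Request (X : Type*) where
  | split (C : Finset X) : Request X
  | merge (q : Finset (Finset X)) : Request X

section Model

variable {X : Type*} [DecidableEq X]

/-- The clusters that may be split: those with points from two or more target clusters. -/
def feasibleSplits (target P : Finset (Finset X)) : Finset (Finset X) :=
  P.filter fun C => 2 ≤ (target.filter fun D => (D ∩ C).Nonempty).card

/-- The feasible merges: the pairs of distinct clusters which both have a point of the same target
cluster. -/
def feasibleMerges (target P : Finset (Finset X)) : Finset (Finset (Finset X)) :=
  (P.powersetCard 2).filter fun q => ∃ D ∈ target, ∀ C ∈ q, (C ∩ D).Nonempty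

/-- Feasibility of a request in the unrestricted-merge model. -/
def Feasible (target P : Finset (Finset X)) : Request X → Prop
  | .split C => C ∈ feasibleSplits target P
  | .merge q => q ∈ feasibleMerges target P

/-- The edit of the clustering `P` made on a request. A split replaces the cluster by the two parts
that the split procedure returns. A merge applies the split procedure to the union of the
two clusters: if that gives back the two clusters, they are replaced by their union, otherwise by
the two sets that it returns. -/
def edit (T : LinkageTree X) (P : Finset (Finset X)) : Request X → Finset (Finset X)
  | .split C => (P.erase C) ∪ {(T.split C).1, (T.split C).2}
  | .merge q =>
      if ({(T.split (q.biUnion id)).1, (T.split (q.biUnion id)).2} : Finset (Finset X)) = q then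
        (P \ q) ∪ {q.biUnion id}
      else
        (P \ q) ∪ {(T.split (q.biUnion id)).1, (T.split (q.biUnion id)).2}

/-- The current clustering after a history of requests, when the initial clustering is `P₀`.
Histories list the most recent request first. -/
def current (T : LinkageTree X) (P₀ : Finset (Finset X)) : List (Request X) → Finset (Finset X)
  | [] => P₀
  | r :: h => edit T (current T P₀ h) r

/-- The histories that can occur in the unrestricted-merge model: every request was feasible when it
was made, and was made before the target was reached. -/
def ValidHistory (T : LinkageTree X) (target P₀ : Finset (Finset X)) :
    List (Request X) → Prop
  | [] => True
  | r :: h => ValidHistory T target P₀ h ∧ current T P₀ h ≠ target ∧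
      Feasible target (current T P₀ h) r

/-- An oracle for the unrestricted-merge model with random merges. It chooses the next request by a
probability distribution that may depend on the whole history. As long as the target has not been
reached, all its requests are feasible, and all feasible merges are equally likely, so that
the request is uniformly distributed on the feasible merges given that it is a merge request.
Whether to request a split, and which one, is otherwise arbitrary. -/
def IsRandomMergeOracle (T : LinkageTree X) (target P₀ : Finset (Finset X))
    (oracle : List (Request X) → PMF (Request X)) : Prop :=
  ∀ h : List (Request X), ValidHistory T target P₀ h → current T P₀ h ≠ target →
    (∀ r ∈ (oracle h).support, Feasible target (current T P₀ h) r) ∧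
    (∀ q ∈ feasibleMerges target (current T P₀ h), ∀ q' ∈ feasibleMerges target (current T P₀ h),
      oracle h (.merge q) = oracle h (.merge q'))

/-- The distribution of the history of the interaction after at most `n` requests. The interaction
ends as soon as the current clustering is the target. -/
noncomputable def history (T : LinkageTree X) (target P₀ : Finset (Finset X))
    (oracle : List (Request X) → PMF (Request X)) : ℕ → PMF (List (Request X))
  | 0 => PMF.pure []
  | n + 1 => (history T target P₀ oracle n).bind fun h =>
      if current T P₀ h = target then PMF.pure h else (oracle h).map fun r => r :: h

end Model

/-- The number of split requests in a history. -/
def splitCount {X : Type*} : List (Request X) → ℕ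
  | [] => 0
  | .split _ :: h => splitCount h + 1
  | .merge _ :: h => splitCount h

/-- The number of merge requests in a history. -/
def mergeCount {X : Type*} : List (Request X) → ℕ
  | [] => 0
  | .split _ :: h => mergeCount h
  | .merge _ :: h => mergeCount h + 1

end InteractiveClustering

open InteractiveClustering

/-! The bound on the number of merge requests holds surely, not only with high probability: the
potential `totalPotential` counts the pairs of pieces of each target cluster, those that the tree
does not separate twice, and every answer to a merge request lowers it. -/

namespace InteractiveClustering

/-! Every history that can occur has at most `δₒ` splits and `2 δᵤ²` merges, so the event has
probability one; as `log (k / ε) ≥ log 2`, the constant `K = 3` suffices.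

Stability makes each node of the tree disjoint from, inside or around each target cluster
(`IsAverageLinkageTree.compatibleForest`). Otherwise a linkage step would join a proper part `a` of
a cluster `D` to a node `b` outside `D`. By stability `S(a, D \ a) > S(a, b)`, and `D \ a` is a
union of current nodes, so one of these is closer to `a` than `b` is. Hence the split of a set not
inside one target cluster cuts no target cluster: it leaves the pieces `C ∩ D` unchanged and lowers
the overclustering error.

For merges, give two distinct pieces of the same target cluster weight 1 if disjoint nodes of the
tree contain them, and 2 if not. A merge of `A` and `B` lowers the total over ordered pairs by at
least 2 (`edit_merge`). If the answer is their union, or a clean split of it, then the pieces of `A`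
and `B` in each target cluster are united. The remaining answer redistributes `A ∪ B` inside one
target cluster. In that case `A` and `B` were not separated, since otherwise the split would return
them; the new parts are, and weights to third pieces do not increase in total. The initial potential
is at most `4 δᵤ²`. -/

theorem not_nonempty_of_subset_disjoint {X : Type*} {B M N : Finset X} (hB : B.Nonempty)
    (h₁ : B ⊆ M) (h₂ : B ⊆ N) (hd : Disjoint M N) : False := by
  obtain ⟨x, hx⟩ := hB
  exact Finset.disjoint_left.1 hd (h₁ hx) (h₂ hx)

/-! ### Laminarity and separation in a tree -/

section TreeNodes

variable {X : Type*} [DecidableEq X]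

/-- The point sets of the nodes of a tree. -/
def LinkageTree.nodes : LinkageTree X → Set (Finset X)
  | .leaf x => {{x}}
  | .node l r => insert (l.points ∪ r.points) (l.nodes ∪ r.nodes)

/-- No point occurs at two different leaves. -/
def LinkageTree.Proper : LinkageTree X → Prop
  | .leaf _ => True
  | .node l r => Disjoint l.points r.points ∧ l.Proper ∧ r.Proper

theorem LinkageTree.points_nonempty (T : LinkageTree X) : T.points.Nonempty := by
  induction T with
  | leaf x => exact Finset.singleton_nonempty x
  | node l r hl _ => exact hl.mono Finset.subset_union_left

theorem LinkageTree.points_mem_nodes (T : LinkageTree X) : T.points ∈ T.nodes := by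
  cases T with
  | leaf x => exact Set.mem_singleton _
  | node l r => exact Set.mem_insert _ _

theorem LinkageTree.subset_points_of_mem_nodes {T : LinkageTree X} {N : Finset X}
    (hN : N ∈ T.nodes) : N ⊆ T.points := by
  induction T with
  | leaf x =>
    rw [Set.mem_singleton_iff.1 hN]
    exact Finset.Subset.refl _
  | node l r hl hr =>
    rcases hN with rfl | hN | hN
    · exact Finset.Subset.refl _
    · exact (hl hN).trans Finset.subset_union_left
    · exact (hr hN).trans Finset.subset_union_right

theorem LinkageTree.Proper.laminar {T : LinkageTree X} (hT : T.Proper) {M N : Finset X}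
    (hM : M ∈ T.nodes) (hN : N ∈ T.nodes) : Disjoint M N ∨ M ⊆ N ∨ N ⊆ M := by
  induction T with
  | leaf x =>
    rw [Set.mem_singleton_iff.1 hM, Set.mem_singleton_iff.1 hN]
    exact Or.inr (Or.inl (Finset.Subset.refl _))
  | node l r hl hr =>
    obtain ⟨hd, pl, pr⟩ := hT
    have hM' := LinkageTree.subset_points_of_mem_nodes hM
    have hN' := LinkageTree.subset_points_of_mem_nodes hN
    rcases hM with rfl | hM | hM
    · exact Or.inr (Or.inr hN')
    · rcases hN with rfl | hN | hN
      · exact Or.inr (Or.inl hM')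
      · exact hl pl hM hN
      · exact Or.inl (hd.mono (subset_points_of_mem_nodes hM) (subset_points_of_mem_nodes hN))
    · rcases hN with rfl | hN | hN
      · exact Or.inr (Or.inl hM')
      · exact Or.inl (hd.symm.mono (subset_points_of_mem_nodes hM)
          (subset_points_of_mem_nodes hN))
      · exact hr pr hM hN

/-- `L` and `R` are the two children of a node of `T`. -/
structure LinkageTree.Siblings (T : LinkageTree X) (L R : Finset X) : Prop where
  left_mem : L ∈ T.nodes
  right_mem : R ∈ T.nodes
  union_mem : L ∪ R ∈ T.nodes
  disjoint : Disjoint L R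

/-- Replaces the recursion by the one node at which `U` is cut. Two points are needed to exclude
ending in a leaf. -/
theorem LinkageTree.exists_split {T : LinkageTree X} (hT : T.Proper) {U : Finset X}
    (hU : U ⊆ T.points) (h2 : 2 ≤ U.card) :
    ∃ L R, T.Siblings L R ∧ U ⊆ L ∪ R ∧ (L ∩ U).Nonempty ∧ (R ∩ U).Nonempty ∧
      T.split U = (L ∩ U, R ∩ U) := by
  induction T with
  | leaf x =>
    have := Finset.card_le_card hU
    simp only [LinkageTree.points, Finset.card_singleton] at this
    omega
  | node l r hl hr =>
    obtain ⟨hd, pl, pr⟩ := hT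
    by_cases h₁ : U ⊆ l.points
    · obtain ⟨L, R, hs, h⟩ := hl pl h₁
      refine ⟨L, R, ⟨Or.inr (Or.inl hs.1), Or.inr (Or.inl hs.2), Or.inr (Or.inl hs.3), hs.4⟩, ?_⟩
      simpa [LinkageTree.split, h₁] using h
    · by_cases h₃ : U ⊆ r.points
      · obtain ⟨L, R, hs, h⟩ := hr pr h₃
        refine ⟨L, R, ⟨Or.inr (Or.inr hs.1), Or.inr (Or.inr hs.2), Or.inr (Or.inr hs.3), hs.4⟩, ?_⟩
        simpa [LinkageTree.split, h₁, h₃] using h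
      · refine ⟨l.points, r.points, ⟨Or.inr (Or.inl l.points_mem_nodes),
          Or.inr (Or.inr r.points_mem_nodes), Or.inl rfl, hd⟩, hU, ?_, ?_, ?_⟩
        · obtain ⟨x, hx, hx'⟩ := Finset.not_subset.1 h₃
          have := Finset.mem_union.1 (hU hx)
          exact ⟨x, Finset.mem_inter.2 ⟨this.resolve_right hx', hx⟩⟩
        · obtain ⟨x, hx, hx'⟩ := Finset.not_subset.1 h₁
          have := Finset.mem_union.1 (hU hx)
          exact ⟨x, Finset.mem_inter.2 ⟨this.resolve_left hx', hx⟩⟩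
        · simp [LinkageTree.split, h₁, h₃]

/-- Laminarity with respect to `L`, `R` and `L ∪ R` leaves nothing strictly between a child and its
parent: a node inside the union and disjoint from one child is inside the other. -/
theorem LinkageTree.Siblings.cases {T : LinkageTree X} (hT : T.Proper) {L R N : Finset X}
    (h : T.Siblings L R) (hN : N ∈ T.nodes) :
    Disjoint N (L ∪ R) ∨ L ∪ R ⊆ N ∨ N ⊆ L ∨ N ⊆ R := by
  rcases hT.laminar hN h.left_mem with h₁ | h₁ | h₁
  · rcases hT.laminar hN h.union_mem with h₂ | h₂ | h₂
    · exact Or.inl h₂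
    · exact Or.inr (Or.inr (Or.inr (h₁.left_le_of_le_sup_left h₂)))
    · exact Or.inr (Or.inl h₂)
  · exact Or.inr (Or.inr (Or.inl h₁))
  · rcases hT.laminar hN h.right_mem with h₂ | h₂ | h₂
    · rcases hT.laminar hN h.union_mem with h₃ | h₃ | h₃
      · exact Or.inl h₃
      · exact Or.inr (Or.inr (Or.inl (h₂.left_le_of_le_sup_right h₃)))
      · exact Or.inr (Or.inl h₃)
    · exact Or.inr (Or.inr (Or.inr h₂))
    · exact Or.inr (Or.inl (Finset.union_subset h₁ h₂))

/-- Two sets of points are separated if they lie below disjoint nodes of the tree. -/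
def LinkageTree.Separated (T : LinkageTree X) (A B : Finset X) : Prop :=
  ∃ M ∈ T.nodes, ∃ N ∈ T.nodes, A ⊆ M ∧ B ⊆ N ∧ Disjoint M N

theorem LinkageTree.Separated.symm {T : LinkageTree X} {A B : Finset X}
    (h : T.Separated A B) : T.Separated B A := by
  obtain ⟨M, hM, N, hN, hA, hB, hd⟩ := h
  exact ⟨N, hN, M, hM, hB, hA, hd.symm⟩

theorem pair_eq_of_subset_siblings {A B L R : Finset X} (hd : Disjoint L R)
    (hA : A ⊆ L) (hB : B ⊆ R) : L ∩ (A ∪ B) = A ∧ R ∩ (A ∪ B) = B := by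
  constructor
  · ext x
    have h₁ : x ∈ A → _ := fun h => hA h
    have h₂ : x ∈ B → _ := fun h => hB h
    have h₃ : x ∈ L → x ∉ R := fun h => Finset.disjoint_left.1 hd h
    simp only [Finset.mem_inter, Finset.mem_union]
    tauto
  · ext x
    have h₁ : x ∈ A → _ := fun h => hA h
    have h₂ : x ∈ B → _ := fun h => hB h
    have h₃ : x ∈ L → x ∉ R := fun h => Finset.disjoint_left.1 hd h
    simp only [Finset.mem_inter, Finset.mem_union]
    tauto

/-- The split procedure separates the union of two separated sets into these sets. -/
theorem LinkageTree.Separated.pair_eq {T : LinkageTree X} (hT : T.Proper) {A B L R : Finset X}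
    (h : T.Separated A B) (hA : A.Nonempty) (hB : B.Nonempty) (hs : T.Siblings L R)
    (hU : A ∪ B ⊆ L ∪ R) (hL : (L ∩ (A ∪ B)).Nonempty) (hR : (R ∩ (A ∪ B)).Nonempty) :
    ({L ∩ (A ∪ B), R ∩ (A ∪ B)} : Finset (Finset X)) = {A, B} := by
  obtain ⟨M, hM, N, hN, hAM, hBN, hd⟩ := h
  -- The node around `A` cannot contain the whole split node, for it would then contain `B` too. So
  -- it lies below one child.
  have hA' : A ⊆ L ∨ A ⊆ R := by
    rcases hs.cases hT hM with h | h | h | h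
    · exact (not_nonempty_of_subset_disjoint hA hAM (Finset.subset_union_left.trans hU) h).elim
    · exact (not_nonempty_of_subset_disjoint hB
        ((Finset.subset_union_right.trans hU).trans h) hBN hd).elim
    · exact Or.inl (hAM.trans h)
    · exact Or.inr (hAM.trans h)
  have hB' : B ⊆ L ∨ B ⊆ R := by
    rcases hs.cases hT hN with h | h | h | h
    · exact (not_nonempty_of_subset_disjoint hB hBN (Finset.subset_union_right.trans hU) h).elim
    · exact (not_nonempty_of_subset_disjoint hA hAM
        ((Finset.subset_union_left.trans hU).trans h) hd).elim
    · exact Or.inl (hBN.trans h)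
    · exact Or.inr (hBN.trans h)
  rcases hA' with hA' | hA' <;> rcases hB' with hB' | hB'
  · exact (not_nonempty_of_subset_disjoint hR
      (Finset.inter_subset_right.trans (Finset.union_subset hA' hB'))
      Finset.inter_subset_left hs.disjoint).elim
  · obtain ⟨h₁, h₂⟩ := pair_eq_of_subset_siblings hs.disjoint hA' hB'
    rw [h₁, h₂]
  · obtain ⟨h₁, h₂⟩ := pair_eq_of_subset_siblings hs.disjoint hB' hA'
    rw [Finset.union_comm B A] at h₁ h₂
    rw [h₁, h₂, Finset.pair_comm]
  · exact (not_nonempty_of_subset_disjoint hL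
      (Finset.inter_subset_right.trans (Finset.union_subset hA' hB'))
      Finset.inter_subset_left hs.disjoint.symm).elim

/-- A set separated from two non-separated sets is separated from all subsets of their union. -/
theorem LinkageTree.Proper.separated_of_separated {T : LinkageTree X} (hT : T.Proper)
    {A B C E : Finset X} (hAB : ¬ T.Separated A B) (hA : T.Separated A C)
    (hB : T.Separated B C) (hE : E ⊆ A ∪ B) : T.Separated E C := by
  obtain ⟨M, hM, N, hN, hAM, hCN, hd⟩ := hA
  obtain ⟨M', hM', N', hN', hBM', hCN', hd'⟩ := hB
  -- Since `A` and `B` are not separated, the two nodes around them are nested; the larger contains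
  -- `E` and has its own partner around `C`.
  rcases hT.laminar hM hM' with h | h | h
  · exact (hAB ⟨M, hM, M', hM', hAM, hBM', h⟩).elim
  · exact ⟨M', hM', N', hN', hE.trans (Finset.union_subset (hAM.trans h) hBM'), hCN', hd'⟩
  · exact ⟨M, hM, N, hN, hE.trans (Finset.union_subset hAM (hBM'.trans h)), hCN, hd⟩

/-- A set separated from part of a set is separated from one of the two parts into which the
latter is split. -/
theorem LinkageTree.Siblings.separated_or {T : LinkageTree X} (hT : T.Proper)
    {A C U L R : Finset X} (hs : T.Siblings L R) (hU : U ⊆ L ∪ R) (hA : A.Nonempty) (hAU : A ⊆ U)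
    (h : T.Separated A C) : T.Separated (L ∩ U) C ∨ T.Separated (R ∩ U) C := by
  obtain ⟨M, hM, N, hN, hAM, hCN, hd⟩ := h
  -- The node around `C` is not above the split, since it misses `A`. Outside the split node it is
  -- separated from both parts, below one child from the part in the other.
  rcases hs.cases hT hN with h | h | h | h
  · exact Or.inl ⟨L ∪ R, hs.union_mem, N, hN, Finset.inter_subset_right.trans hU, hCN, h.symm⟩
  · exact (not_nonempty_of_subset_disjoint hA hAM ((hAU.trans hU).trans h) hd).elim
  · exact Or.inr ⟨R, hs.right_mem, L, hs.left_mem, Finset.inter_subset_left, hCN.trans h,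
      hs.disjoint.symm⟩
  · exact Or.inl ⟨L, hs.left_mem, R, hs.right_mem, Finset.inter_subset_left, hCN.trans h,
      hs.disjoint⟩

end TreeNodes

/-! ### The potential of a family of pieces -/

section Potential

variable {X : Type*} [DecidableEq X]

open Classical in
/-- The weight of a pair of pieces: pairs that are not separated by the tree count twice. -/
noncomputable def pairWeight (T : LinkageTree X) (A B : Finset X) : ℕ :=
  if A = B then 0 else if T.Separated A B then 1 else 2

/-- The total weight of a family of pieces. -/
noncomputable def potential (T : LinkageTree X) (Q : Finset (Finset X)) : ℕ :=
  ∑ A ∈ Q, ∑ B ∈ Q, pairWeight T A B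

variable {T : LinkageTree X}

theorem pairWeight_self (A : Finset X) : pairWeight T A A = 0 := if_pos rfl

theorem pairWeight_comm (A B : Finset X) : pairWeight T A B = pairWeight T B A := by
  unfold pairWeight
  have : T.Separated A B ↔ T.Separated B A := ⟨fun h => h.symm, fun h => h.symm⟩
  by_cases h : T.Separated A B
  · rw [if_pos h, if_pos (this.1 h)]
    simp only [eq_comm]
  · rw [if_neg h, if_neg fun h' => h (this.2 h')]
    simp only [eq_comm]

theorem pairWeight_le_two (A B : Finset X) : pairWeight T A B ≤ 2 := by
  unfold pairWeight
  split_ifs <;> omega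

theorem one_le_pairWeight {A B : Finset X} (h : A ≠ B) : 1 ≤ pairWeight T A B := by
  unfold pairWeight
  rw [if_neg h]
  split_ifs <;> omega

theorem pairWeight_le_one {A B : Finset X} (h : T.Separated A B) : pairWeight T A B ≤ 1 := by
  unfold pairWeight
  split_ifs <;> omega

theorem pairWeight_eq_two {A B : Finset X} (hne : A ≠ B) (h : ¬ T.Separated A B) :
    pairWeight T A B = 2 := by
  unfold pairWeight
  rw [if_neg hne, if_neg h]

theorem sum_insert_le_add {α : Type*} [DecidableEq α] (f : α → ℕ) (a : α) (s : Finset α) :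
    ∑ x ∈ insert a s, f x ≤ f a + ∑ x ∈ s, f x := by
  by_cases h : a ∈ s
  · rw [Finset.insert_eq_of_mem h]
    exact Nat.le_add_left _ _
  · rw [Finset.sum_insert h]

/-- The factor 2 appears because ordered pairs are summed; the diagonal has weight zero. -/
theorem potential_insert {A : Finset X} {Q : Finset (Finset X)} (h : A ∉ Q) :
    potential T (insert A Q) = potential T Q + 2 * ∑ C ∈ Q, pairWeight T A C := by
  unfold potential
  have : ∀ B, ∑ C ∈ insert A Q, pairWeight T B C
      = pairWeight T A B + ∑ C ∈ Q, pairWeight T B C := fun B => by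
    rw [Finset.sum_insert h, pairWeight_comm]
  rw [Finset.sum_insert h, this, pairWeight_self, Finset.sum_congr rfl fun B _ => this B,
    Finset.sum_add_distrib]
  ring

theorem potential_insert_le (A : Finset X) (Q : Finset (Finset X)) :
    potential T (insert A Q) ≤ potential T Q + 2 * ∑ C ∈ Q, pairWeight T A C := by
  by_cases h : A ∈ Q
  · rw [Finset.insert_eq_of_mem h]
    exact Nat.le_add_right _ _
  · rw [potential_insert h]

theorem potential_pair {A B : Finset X} {Q : Finset (Finset X)} (hA : A ∉ Q) (hB : B ∉ Q)
    (h : A ≠ B) : potential T (insert A (insert B Q)) =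
      potential T Q + 2 * ∑ C ∈ Q, (pairWeight T A C + pairWeight T B C)
        + 2 * pairWeight T A B := by
  rw [potential_insert (by simp [h, hA]), potential_insert hB, Finset.sum_insert hB,
    Finset.sum_add_distrib]
  ring

/-- New pieces need only an upper bound, which holds even if they coincide with each other or with
old ones. -/
theorem potential_pair_le (A B : Finset X) (Q : Finset (Finset X)) :
    potential T (insert A (insert B Q)) ≤
      potential T Q + 2 * ∑ C ∈ Q, (pairWeight T A C + pairWeight T B C)
        + 2 * pairWeight T A B := by
  have h₁ := potential_insert_le (T := T) A (insert B Q)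
  have h₂ := potential_insert_le (T := T) B Q
  have h₃ := sum_insert_le_add (pairWeight T A) B Q
  rw [Finset.sum_add_distrib]
  omega

/-- Uniting two pieces lowers the potential. -/
theorem potential_union_add_two_le {A B : Finset X} {Q : Finset (Finset X)} (hA : A ∉ Q)
    (hB : B ∉ Q) (h : A ≠ B) :
    potential T (insert (A ∪ B) Q) + 2 ≤ potential T (insert A (insert B Q)) := by
  have h₁ := potential_insert_le (T := T) (A ∪ B) Q
  have h₂ := one_le_pairWeight (T := T) h
  -- One pair costs at most 2, the two pairs it replaces at least 1 each.
  have h₃ : ∑ C ∈ Q, pairWeight T (A ∪ B) C ≤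
      ∑ C ∈ Q, (pairWeight T A C + pairWeight T B C) := by
    refine Finset.sum_le_sum fun C hC => ?_
    have := pairWeight_le_two (T := T) (A ∪ B) C
    have := one_le_pairWeight (T := T) (ne_of_mem_of_not_mem hC hA).symm
    have := one_le_pairWeight (T := T) (ne_of_mem_of_not_mem hC hB).symm
    omega
  rw [potential_pair hA hB h]
  omega

/-- Splitting the union of two pieces that are not separated lowers the potential. -/
theorem potential_split_add_two_le (hT : T.Proper) {A B L R : Finset X}
    {Q : Finset (Finset X)} (hA : A ∉ Q) (hB : B ∉ Q) (h : A ≠ B) (hA₀ : A.Nonempty)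
    (hB₀ : B.Nonempty) (hAB : ¬ T.Separated A B)
    (hs : T.Siblings L R) (hU : A ∪ B ⊆ L ∪ R) :
    potential T (insert (L ∩ (A ∪ B)) (insert (R ∩ (A ∪ B)) Q)) + 2 ≤
      potential T (insert A (insert B Q)) := by
  have h₁ := potential_pair_le (T := T) (L ∩ (A ∪ B)) (R ∩ (A ∪ B)) Q
  have h₂ := pairWeight_eq_two h hAB
  have h₃ : pairWeight T (L ∩ (A ∪ B)) (R ∩ (A ∪ B)) ≤ 1 :=
    pairWeight_le_one ⟨L, hs.left_mem, R, hs.right_mem, Finset.inter_subset_left,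
      Finset.inter_subset_left, hs.disjoint⟩
  have h₄ : ∑ C ∈ Q, (pairWeight T (L ∩ (A ∪ B)) C + pairWeight T (R ∩ (A ∪ B)) C) ≤
      ∑ C ∈ Q, (pairWeight T A C + pairWeight T B C) := by
    refine Finset.sum_le_sum fun C hC => ?_
    have hAC := (ne_of_mem_of_not_mem hC hA).symm
    have hBC := (ne_of_mem_of_not_mem hC hB).symm
    have a₁ := one_le_pairWeight (T := T) hAC
    have a₂ := one_le_pairWeight (T := T) hBC
    have a₃ := pairWeight_le_two (T := T) (L ∩ (A ∪ B)) C
    have a₄ := pairWeight_le_two (T := T) (R ∩ (A ∪ B)) C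
    -- At least as many of the two new parts are separated from `C` as of `A` and `B`: two by
    -- `separated_of_separated`, one by `separated_or`.
    by_cases sA : T.Separated A C <;> by_cases sB : T.Separated B C
    · have := pairWeight_le_one
        (hT.separated_of_separated hAB sA sB (E := L ∩ (A ∪ B)) Finset.inter_subset_right)
      have := pairWeight_le_one
        (hT.separated_of_separated hAB sA sB (E := R ∩ (A ∪ B)) Finset.inter_subset_right)
      omega
    · have := pairWeight_eq_two hBC sB
      rcases hs.separated_or hT hU hA₀ Finset.subset_union_left sA with h | h <;>
        have := pairWeight_le_one h <;> omega
    · have := pairWeight_eq_two hAC sA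
      rcases hs.separated_or hT hU hB₀ Finset.subset_union_right sB with h | h <;>
        have := pairWeight_le_one h <;> omega
    · have := pairWeight_eq_two hBC sB
      have := pairWeight_eq_two hAC sA
      omega
  rw [potential_pair hA hB h]
  omega

/-- With `m` pieces the total is at most `2m(m - 1)`, and `m ≤ 2(m - 1)` once `m ≥ 2`. The square of
`m - 1` is what `clusterDist` measures. -/
theorem potential_le (Q : Finset (Finset X)) :
    potential T Q ≤ 4 * (Q.card - 1) ^ 2 := by
  have h : ∀ A ∈ Q, ∑ B ∈ Q, pairWeight T A B ≤ (Q.card - 1) * 2 := fun A hA => by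
    rw [← Finset.add_sum_erase _ _ hA, pairWeight_self, zero_add, ← Finset.card_erase_of_mem hA]
    exact Finset.sum_le_card_nsmul _ _ _ fun B _ => pairWeight_le_two A B
  have h₁ : potential T Q ≤ Q.card * ((Q.card - 1) * 2) := Finset.sum_le_card_nsmul _ _ _ h
  refine h₁.trans ?_
  obtain h0 | h1 | ⟨m, hm⟩ : Q.card = 0 ∨ Q.card = 1 ∨ ∃ m, Q.card = m + 2 := by
    rcases Q.card with _ | _ | m
    · exact Or.inl rfl
    · exact Or.inr (Or.inl rfl)
    · exact Or.inr (Or.inr ⟨m, rfl⟩)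
  · simp [h0]
  · simp [h1]
  · rw [hm, show m + 2 - 1 = m + 1 from rfl]
    nlinarith

end Potential

/-! ### Average linkage respects stable clusterings -/

section Linkage

variable {X : Type*}

/-- A set of points is compatible with a family of clusters if it is disjoint from, contained in or
contains each of them. -/
def Compatible (P : Finset (Finset X)) (N : Finset X) : Prop :=
  ∀ D ∈ P, Disjoint N D ∨ N ⊆ D ∨ D ⊆ N

theorem avgSim_comm {S : X → X → ℝ} (hS : ∀ x y, S x y = S y x) (A B : Finset X) :
    avgSim S A B = avgSim S B A := by
  unfold avgSim
  rw [Finset.sum_comm, mul_comm]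
  simp only [hS]

/-- The total similarity of `A` and `B` in excess of `M` for each pair of points. -/
noncomputable def excess (S : X → X → ℝ) (M : ℝ) (A B : Finset X) : ℝ :=
  ∑ y ∈ B, ∑ x ∈ A, (S x y - M)

theorem excess_eq {S : X → X → ℝ} {M : ℝ} {A B : Finset X} (hA : A.Nonempty) (hB : B.Nonempty) :
    excess S M A B = (avgSim S A B - M) * ((A.card : ℝ) * B.card) := by
  have h₁ : (A.card : ℝ) ≠ 0 := by exact_mod_cast hA.card_pos.ne'
  have h₂ : (B.card : ℝ) ≠ 0 := by exact_mod_cast hB.card_pos.ne'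
  unfold excess avgSim
  rw [Finset.sum_comm]
  simp only [Finset.sum_sub_distrib, Finset.sum_const, nsmul_eq_mul]
  field_simp

theorem excess_neg_iff {S : X → X → ℝ} {M : ℝ} {A B : Finset X} (hA : A.Nonempty)
    (hB : B.Nonempty) : excess S M A B < 0 ↔ avgSim S A B < M := by
  have h : (0 : ℝ) < (A.card : ℝ) * B.card := by
    have h₁ : (0 : ℝ) < A.card := by exact_mod_cast hA.card_pos
    have h₂ : (0 : ℝ) < B.card := by exact_mod_cast hB.card_pos
    positivity
  rw [excess_eq hA hB, mul_neg_iff]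
  constructor
  · rintro (⟨_, h'⟩ | ⟨h', _⟩) <;> linarith
  · exact fun h' => Or.inr ⟨by linarith, h⟩

variable [DecidableEq X]

/-- The excess over `M` is additive over disjoint unions, and its sign compares the average with
`M`. -/
theorem avgSim_biUnion_lt {S : X → X → ℝ} {M : ℝ} {A B : Finset X} {G : Finset (Finset X)}
    {f : Finset X → Finset X} (hA : A.Nonempty) (hB : B.Nonempty) (hG : B = G.biUnion f)
    (hd : ∀ C ∈ G, ∀ D ∈ G, C ≠ D → Disjoint (f C) (f D)) (hne : ∀ C ∈ G, (f C).Nonempty)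
    (h : ∀ C ∈ G, avgSim S A (f C) < M) : avgSim S A B < M := by
  rw [← excess_neg_iff hA hB]
  subst hG
  unfold excess
  rw [Finset.sum_biUnion fun C hC D hD hCD => hd C hC D hD hCD]
  obtain ⟨x, hx⟩ := hB
  obtain ⟨C, hC, -⟩ := Finset.mem_biUnion.1 hx
  exact Finset.sum_neg (fun C hC => (excess_neg_iff hA (hne C hC)).2 (h C hC)) ⟨C, hC⟩

/-- The invariant of bottom-up average linkage for a stable clustering. -/
structure CompatibleForest (P : Finset (Finset X)) (F : Set (LinkageTree X)) : Prop where
  proper : ∀ a ∈ F, a.Proper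
  disjoint : ∀ a ∈ F, ∀ b ∈ F, a ≠ b → Disjoint a.points b.points
  cover : ∀ x, ∃ a ∈ F, x ∈ a.points
  compatible : ∀ a ∈ F, ∀ N ∈ a.nodes, Compatible P N

variable [Fintype X]

/-- A proper part `a` of a target cluster `D` has a larger average similarity to some current node
in `D` than to a node outside of `D`. -/
theorem CompatibleForest.not_maximal {S : X → X → ℝ}
    {P : Finpartition (Finset.univ : Finset X)} (hS : Stable S P.parts)
    {F : Set (LinkageTree X)} (hF : CompatibleForest P.parts F) {a b : LinkageTree X}
    (ha : a ∈ F) {D : Finset X} (hD : D ∈ P.parts) (haD : a.points ⊂ D)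
    (hbD : Disjoint b.points D)
    (hmax : ∀ c ∈ F, c ≠ a → avgSim S a.points c.points ≤ avgSim S a.points b.points) : False := by
  classical
  have hne : (D \ a.points).Nonempty := Finset.sdiff_nonempty.2 haD.2
  -- Stability speaks of parts of a single cluster, so `b` is first cut along the target clusters.
  have h₁ : avgSim S a.points b.points < avgSim S a.points (D \ a.points) := by
    refine avgSim_biUnion_lt (G := P.parts.filter fun E => (E ∩ b.points).Nonempty)
      (f := fun E => E ∩ b.points) a.points_nonempty b.points_nonempty ?_ ?_ ?_ ?_
    · ext x
      simp only [Finset.mem_biUnion, Finset.mem_filter, Finset.mem_inter]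
      constructor
      · intro hx
        obtain ⟨E, hE, hxE⟩ := P.exists_mem (Finset.mem_univ x)
        exact ⟨E, ⟨hE, x, Finset.mem_inter.2 ⟨hxE, hx⟩⟩, hxE, hx⟩
      · rintro ⟨E, -, -, hx⟩
        exact hx
    · intro C hC E hE hCE
      exact (P.disjoint (Finset.mem_filter.1 hC).1 (Finset.mem_filter.1 hE).1 hCE).mono
        Finset.inter_subset_left Finset.inter_subset_left
    · exact fun C hC => (Finset.mem_filter.1 hC).2
    · intro E hE
      obtain ⟨hE, hEb⟩ := Finset.mem_filter.1 hE
      refine hS D hD E hE ?_ _ _ a.points_nonempty haD hEb Finset.inter_subset_left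
      rintro rfl
      exact not_nonempty_of_subset_disjoint hEb Finset.inter_subset_right
        Finset.inter_subset_left hbD
  -- By compatibility, current nodes partition `D \ a`. Maximality of `b` puts each of them below
  -- the average over `D \ a`, so that average would be below itself.
  have h₂ : avgSim S a.points (D \ a.points) < avgSim S a.points (D \ a.points) := by
    refine avgSim_biUnion_lt (f := id) (G := Finset.univ.filter fun N =>
      N ⊆ D \ a.points ∧ ∃ c ∈ F, c.points = N) a.points_nonempty hne ?_ ?_ ?_ ?_
    · ext x
      simp only [Finset.mem_biUnion, Finset.mem_filter, id, Finset.mem_univ, true_and]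
      constructor
      · intro hx
        obtain ⟨c, hc, hxc⟩ := hF.cover x
        obtain ⟨hxD, hxa⟩ := Finset.mem_sdiff.1 hx
        have hca : c ≠ a := by
          rintro rfl
          exact hxa hxc
        have hd := hF.disjoint c hc a ha hca
        refine ⟨c.points, ⟨?_, c, hc, rfl⟩, hxc⟩
        refine Finset.subset_sdiff.2 ⟨?_, hd⟩
        rcases hF.compatible c hc _ c.points_mem_nodes D hD with h | h | h
        · exact (Finset.disjoint_left.1 h hxc hxD).elim
        · exact h
        · exact (not_nonempty_of_subset_disjoint a.points_nonempty (haD.1.trans h)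
            (Finset.Subset.refl _) hd).elim
      · rintro ⟨N, ⟨h, -⟩, hx⟩
        exact h hx
    · intro C hC E hE hCE
      obtain ⟨-, -, c, hc, rfl⟩ := Finset.mem_filter.1 hC
      obtain ⟨-, -, e, he, rfl⟩ := Finset.mem_filter.1 hE
      exact hF.disjoint c hc e he fun h => hCE (h ▸ rfl)
    · intro C hC
      obtain ⟨-, -, c, hc, rfl⟩ := Finset.mem_filter.1 hC
      exact c.points_nonempty
    · intro C hC
      obtain ⟨-, hCD, c, hc, rfl⟩ := Finset.mem_filter.1 hC
      refine (hmax c hc ?_).trans_lt h₁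
      rintro rfl
      exact not_nonempty_of_subset_disjoint c.points_nonempty (Finset.Subset.refl _)
        (Finset.Subset.refl _) (Finset.subset_sdiff.1 hCD).2
  exact lt_irrefl _ h₂

/-- Compatibility can fail only at the new node, and only if one child is a proper part of a target
cluster that the other misses; `not_maximal` excludes this. -/
theorem CompatibleForest.step {S : X → X → ℝ} (hsymm : ∀ x y, S x y = S y x)
    {P : Finpartition (Finset.univ : Finset X)} (hS : Stable S P.parts)
    {F F' : Set (LinkageTree X)} (hF : CompatibleForest P.parts F) (h : LinkageStep S F F') :
    CompatibleForest P.parts F' := by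
  obtain ⟨a, ha, b, hb, hab, hmax, rfl⟩ := h
  have hdab := hF.disjoint a ha b hb hab
  have hdisj : ∀ c ∈ F \ {a, b}, Disjoint (LinkageTree.node a b).points c.points := by
    rintro c ⟨hc, hcn⟩
    refine Finset.disjoint_union_left.2 ⟨hF.disjoint a ha c hc ?_, hF.disjoint b hb c hc ?_⟩
    · rintro rfl
      exact hcn (Or.inl rfl)
    · rintro rfl
      exact hcn (Or.inr rfl)
  refine ⟨?_, ?_, ?_, ?_⟩
  · rintro c (rfl | hc)
    · exact ⟨hdab, hF.proper a ha, hF.proper b hb⟩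
    · exact hF.proper c hc.1
  · rintro c (rfl | hc) e (rfl | he) hce
    · exact (hce rfl).elim
    · exact hdisj e he
    · exact (hdisj c hc).symm
    · exact hF.disjoint c hc.1 e he.1 hce
  · intro x
    obtain ⟨c, hc, hx⟩ := hF.cover x
    by_cases h : c ∈ ({a, b} : Set (LinkageTree X))
    · refine ⟨_, Set.mem_insert _ _, ?_⟩
      rcases h with rfl | rfl
      · exact Finset.mem_union_left _ hx
      · exact Finset.mem_union_right _ hx
    · exact ⟨c, Or.inr ⟨hc, h⟩, hx⟩
  · rintro c (rfl | hc) N hN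
    · rcases hN with rfl | hN | hN
      · intro D hD
        rcases hF.compatible a ha _ a.points_mem_nodes D hD with h₁ | h₁ | h₁
        · rcases hF.compatible b hb _ b.points_mem_nodes D hD with h₂ | h₂ | h₂
          · exact Or.inl (Finset.disjoint_union_left.2 ⟨h₁, h₂⟩)
          · by_cases h : D ⊆ b.points
            · exact Or.inr (Or.inr (h.trans Finset.subset_union_right))
            · refine (hF.not_maximal hS (b := a) hb hD ⟨h₂, h⟩ h₁ fun c hc hcb => ?_).elim
              rw [avgSim_comm hsymm b.points a.points]
              exact hmax b hb c hc hcb.symm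
          · exact Or.inr (Or.inr (h₂.trans Finset.subset_union_right))
        · by_cases h : D ⊆ a.points
          · exact Or.inr (Or.inr (h.trans Finset.subset_union_left))
          rcases hF.compatible b hb _ b.points_mem_nodes D hD with h₂ | h₂ | h₂
          · refine (hF.not_maximal hS (b := b) ha hD ⟨h₁, h⟩ h₂ fun c hc hca => ?_).elim
            exact hmax a ha c hc hca.symm
          · exact Or.inr (Or.inl (Finset.union_subset h₁ h₂))
          · exact Or.inr (Or.inr (h₂.trans Finset.subset_union_right))
        · exact Or.inr (Or.inr (h₁.trans Finset.subset_union_left))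
      · exact hF.compatible a ha N hN
      · exact hF.compatible b hb N hN
    · exact hF.compatible c hc.1 N hN

/-- The average-linkage tree is compatible with every stable clustering. -/
theorem IsAverageLinkageTree.compatibleForest {S : X → X → ℝ} (hsymm : ∀ x y, S x y = S y x)
    {P : Finpartition (Finset.univ : Finset X)} (hS : Stable S P.parts) {T : LinkageTree X}
    (hT : IsAverageLinkageTree S T) : CompatibleForest P.parts {T} := by
  have h₀ : CompatibleForest P.parts (Set.range LinkageTree.leaf) := by
    refine ⟨?_, ?_, fun x => ⟨_, ⟨x, rfl⟩, Finset.mem_singleton_self x⟩, ?_⟩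
    · rintro _ ⟨x, rfl⟩
      trivial
    · rintro _ ⟨x, rfl⟩ _ ⟨y, rfl⟩ h
      exact Finset.disjoint_singleton.2 fun hxy => h (hxy ▸ rfl)
    · rintro _ ⟨x, rfl⟩ N hN D hD
      rw [Set.mem_singleton_iff.1 hN]
      by_cases h : x ∈ D
      · exact Or.inr (Or.inl (Finset.singleton_subset_iff.2 h))
      · exact Or.inl (Finset.disjoint_singleton_left.2 h)
  unfold IsAverageLinkageTree at hT
  generalize ({T} : Set (LinkageTree X)) = F at hT
  induction hT with
  | refl => exact h₀
  | tail _ h ih => exact ih.step hsymm hS h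

end Linkage

/-! ### Clusterings and the pieces of target clusters -/

section Dynamics

variable {X : Type*}

/-- A family of clusters: non-empty sets which are pairwise disjoint. -/
structure IsClustering (P : Finset (Finset X)) : Prop where
  nonempty : ∀ C ∈ P, C.Nonempty
  disjoint : ∀ C ∈ P, ∀ D ∈ P, C ≠ D → Disjoint C D

theorem IsClustering.subset {P Q : Finset (Finset X)} (h : IsClustering P) (hQ : Q ⊆ P) :
    IsClustering Q :=
  ⟨fun C hC => h.nonempty C (hQ hC), fun C hC D hD => h.disjoint C (hQ hC) D (hQ hD)⟩

variable [DecidableEq X]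

theorem IsClustering.insert_disjoint {Q : Finset (Finset X)} {U : Finset X} (h : IsClustering Q)
    (hU : U.Nonempty) (hd : ∀ C ∈ Q, Disjoint U C) : IsClustering (insert U Q) := by
  refine ⟨fun C hC => ?_, fun C hC D hD hCD => ?_⟩
  · rcases Finset.mem_insert.1 hC with rfl | hC
    · exact hU
    · exact h.nonempty C hC
  · rcases Finset.mem_insert.1 hC with hC' | hC' <;> rcases Finset.mem_insert.1 hD with hD' | hD'
    · exact (hCD (hC'.trans hD'.symm)).elim
    · exact hC' ▸ hd D hD'
    · exact hD' ▸ (hd C hC').symm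
    · exact h.disjoint C hC' D hD' hCD

/-- Replacing a set by two disjoint parts of it leaves a clustering a clustering. -/
theorem IsClustering.insert_parts {Q : Finset (Finset X)} {U L R : Finset X}
    (h : IsClustering Q) (hd : ∀ C ∈ Q, Disjoint U C) (hLR : Disjoint L R)
    (hL : (L ∩ U).Nonempty) (hR : (R ∩ U).Nonempty) :
    IsClustering (insert (L ∩ U) (insert (R ∩ U) Q)) := by
  refine (h.insert_disjoint hR fun C hC => (hd C hC).mono_left Finset.inter_subset_right).insert_disjoint
    hL ?_
  intro C hC
  rcases Finset.mem_insert.1 hC with rfl | hC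
  · exact hLR.mono Finset.inter_subset_left Finset.inter_subset_left
  · exact (hd C hC).mono_left Finset.inter_subset_right

/-- The non-empty parts into which a family of clusters divides `D`. -/
def pieces (D : Finset X) (P : Finset (Finset X)) : Finset (Finset X) :=
  (P.image fun C => C ∩ D).erase ∅

theorem mem_pieces {D E : Finset X} {P : Finset (Finset X)} :
    E ∈ pieces D P ↔ E.Nonempty ∧ ∃ C ∈ P, C ∩ D = E := by
  rw [pieces, Finset.mem_erase, Finset.mem_image, ← Finset.nonempty_iff_ne_empty]

theorem pieces_insert_of_nonempty {D C : Finset X} (P : Finset (Finset X))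
    (h : (C ∩ D).Nonempty) : pieces D (insert C P) = insert (C ∩ D) (pieces D P) := by
  rw [pieces, Finset.image_insert, Finset.erase_insert_of_ne h.ne_empty, pieces]

theorem pieces_insert_of_eq_empty {D C : Finset X} (P : Finset (Finset X))
    (h : C ∩ D = ∅) : pieces D (insert C P) = pieces D P := by
  rw [pieces, Finset.image_insert, h, Finset.erase_insert_eq_erase, pieces]

theorem notMem_pieces_of_disjoint {D E : Finset X} {Q : Finset (Finset X)} (hE : E.Nonempty)
    (hd : ∀ C ∈ Q, Disjoint E C) : E ∉ pieces D Q := by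
  intro h
  obtain ⟨-, C, hC, rfl⟩ := mem_pieces.1 h
  exact not_nonempty_of_subset_disjoint hE (Finset.Subset.refl _) Finset.inter_subset_left
    (hd C hC)

/-- A clean split does not change the pieces. -/
theorem pieces_insert_parts {D U L R : Finset X} (Q : Finset (Finset X))
    (hLR : Disjoint L R) (h : D ∩ U ⊆ L ∨ D ∩ U ⊆ R) :
    pieces D (insert (L ∩ U) (insert (R ∩ U) Q)) = pieces D (insert U Q) := by
  have key : ∀ L R : Finset X, Disjoint L R → D ∩ U ⊆ L →
      (L ∩ U) ∩ D = U ∩ D ∧ (R ∩ U) ∩ D = ∅ := by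
    intro L R hLR h
    constructor
    · rw [Finset.inter_assoc, Finset.inter_eq_right, Finset.inter_comm]
      exact h
    · rw [Finset.inter_assoc, ← Finset.disjoint_iff_inter_eq_empty, Finset.inter_comm U]
      exact hLR.symm.mono_right h
  rcases h with h | h
  · obtain ⟨h₁, h₂⟩ := key L R hLR h
    rw [Finset.insert_comm, pieces_insert_of_eq_empty _ h₂]
    simp only [pieces, Finset.image_insert, h₁]
  · obtain ⟨h₁, h₂⟩ := key R L hLR.symm h
    rw [pieces_insert_of_eq_empty _ h₂]
    simp only [pieces, Finset.image_insert, h₁]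

theorem potential_pieces_union_add_two_le {T : LinkageTree X} {D A B : Finset X}
    {Q : Finset (Finset X)} (hAB : Disjoint A B) (hA : ∀ C ∈ Q, Disjoint A C)
    (hB : ∀ C ∈ Q, Disjoint B C) (hAD : (A ∩ D).Nonempty) (hBD : (B ∩ D).Nonempty) :
    potential T (pieces D (insert (A ∪ B) Q)) + 2 ≤
      potential T (pieces D (insert A (insert B Q))) := by
  have h : ((A ∪ B) ∩ D).Nonempty :=
    hAD.mono (Finset.inter_subset_inter_right Finset.subset_union_left)
  rw [pieces_insert_of_nonempty _ h, pieces_insert_of_nonempty _ hAD,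
    pieces_insert_of_nonempty _ hBD, Finset.union_inter_distrib_right]
  refine potential_union_add_two_le ?_ ?_ ?_
  · exact notMem_pieces_of_disjoint hAD fun C hC =>
      (hA C hC).mono_left Finset.inter_subset_left
  · exact notMem_pieces_of_disjoint hBD fun C hC =>
      (hB C hC).mono_left Finset.inter_subset_left
  · intro h
    exact not_nonempty_of_subset_disjoint hAD Finset.inter_subset_left
      (h ▸ Finset.inter_subset_left) hAB

theorem potential_pieces_union_le {T : LinkageTree X} {D A B : Finset X}
    {Q : Finset (Finset X)} (hAB : Disjoint A B) (hA : ∀ C ∈ Q, Disjoint A C)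
    (hB : ∀ C ∈ Q, Disjoint B C) :
    potential T (pieces D (insert (A ∪ B) Q)) ≤
      potential T (pieces D (insert A (insert B Q))) := by
  rcases (A ∩ D).eq_empty_or_nonempty with hAD | hAD
  · rw [pieces_insert_of_eq_empty _ hAD]
    simp only [pieces, Finset.image_insert, Finset.union_inter_distrib_right, hAD,
      Finset.empty_union]
    exact le_rfl
  rcases (B ∩ D).eq_empty_or_nonempty with hBD | hBD
  · rw [Finset.insert_comm, pieces_insert_of_eq_empty _ hBD]
    simp only [pieces, Finset.image_insert, Finset.union_inter_distrib_right, hBD,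
      Finset.union_empty]
    exact le_rfl
  exact (Nat.le_add_right _ _).trans
    (potential_pieces_union_add_two_le hAB hA hB hAD hBD)

theorem union_pair {Q : Finset (Finset X)} (A B : Finset X) :
    Q ∪ {A, B} = insert A (insert B Q) := by
  rw [Finset.union_comm, Finset.insert_union, Finset.singleton_union]

theorem mem_feasibleMerges {target P : Finset (Finset X)} {q : Finset (Finset X)} :
    q ∈ feasibleMerges target P ↔
      (q ⊆ P ∧ q.card = 2) ∧ ∃ D ∈ target, ∀ C ∈ q, (C ∩ D).Nonempty := by
  rw [feasibleMerges, Finset.mem_filter, Finset.mem_powersetCard]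

/-! ### The distance to the target -/

/-- The shared cluster `D` is counted for both sets, which makes up for the second `- 1`. -/
theorem clusterDist_union_le {A B D : Finset X} {P : Finset (Finset X)} (hD : D ∈ P)
    (hA : (A ∩ D).Nonempty) (hB : (B ∩ D).Nonempty) :
    clusterDist (A ∪ B) P ≤ clusterDist A P + clusterDist B P := by
  unfold clusterDist
  have h : (P.filter fun E => (E ∩ (A ∪ B)).Nonempty) =
      (P.filter fun E => (E ∩ A).Nonempty) ∪ (P.filter fun E => (E ∩ B).Nonempty) := by
    rw [← Finset.filter_or]
    refine Finset.filter_congr fun E _ => ?_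
    rw [Finset.inter_union_distrib_left, Finset.union_nonempty]
  have h₁ : 0 < ((P.filter fun E => (E ∩ A).Nonempty) ∩
      (P.filter fun E => (E ∩ B).Nonempty)).card := by
    rw [Finset.inter_comm] at hA hB
    exact Finset.card_pos.2 ⟨D, Finset.mem_inter.2 ⟨Finset.mem_filter.2 ⟨hD, hA⟩,
      Finset.mem_filter.2 ⟨hD, hB⟩⟩⟩
  have h₂ := Finset.card_union_add_card_inter (P.filter fun E => (E ∩ A).Nonempty)
    (P.filter fun E => (E ∩ B).Nonempty)
  rw [h]
  omega

/-- The potential of a clustering: the total weight of the pairs of pieces of target clusters. -/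
noncomputable def totalPotential (T : LinkageTree X) (target P : Finset (Finset X)) : ℕ :=
  ∑ D ∈ target, potential T (pieces D P)

/-- Each piece of `D` comes from a cluster meeting `D`; then a sum of squares is at most the square
of the sum. -/
theorem totalPotential_le (T : LinkageTree X) (target P : Finset (Finset X)) :
    totalPotential T target P ≤ 4 * underclusteringError P target ^ 2 := by
  have h : ∀ D ∈ target, potential T (pieces D P) ≤ 4 * clusterDist D P ^ 2 := by
    intro D _
    refine (potential_le _).trans (Nat.mul_le_mul_left _ (Nat.pow_le_pow_left ?_ 2))
    refine Nat.sub_le_sub_right ?_ 1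
    refine le_trans (Finset.card_le_card (t := (P.filter fun B => (B ∩ D).Nonempty).image
      fun C => C ∩ D) fun E hE => ?_) Finset.card_image_le
    obtain ⟨hne, C, hC, rfl⟩ := mem_pieces.1 hE
    exact Finset.mem_image.2 ⟨C, Finset.mem_filter.2 ⟨hC, hne⟩, rfl⟩
  refine (Finset.sum_le_sum h).trans ?_
  rw [← Finset.mul_sum]
  exact Nat.mul_le_mul_left _ (Finset.sum_sq_le_sq_sum_of_nonneg fun _ _ => Nat.zero_le _)

variable [Fintype X] {target : Finpartition (Finset.univ : Finset X)} {T : LinkageTree X}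

theorem exists_mem_target_inter_nonempty (target : Finpartition (Finset.univ : Finset X))
    {A : Finset X} (hA : A.Nonempty) : ∃ D ∈ target.parts, (D ∩ A).Nonempty := by
  obtain ⟨x, hx⟩ := hA
  obtain ⟨D, hD, hxD⟩ := target.exists_mem (Finset.mem_univ x)
  exact ⟨D, hD, x, Finset.mem_inter.2 ⟨hxD, hx⟩⟩

theorem clusterDist_eq_zero {D U : Finset X} (hD : D ∈ target.parts) (hU : U ⊆ D) :
    clusterDist U target.parts = 0 := by
  have : (target.parts.filter fun E => (E ∩ U).Nonempty) ⊆ {D} := by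
    intro E hE
    obtain ⟨hE, hEU⟩ := Finset.mem_filter.1 hE
    rw [Finset.mem_singleton]
    by_contra h
    exact not_nonempty_of_subset_disjoint hEU Finset.inter_subset_left
      (Finset.inter_subset_right.trans hU) (target.disjoint hE hD h)
  have := Finset.card_le_card this
  rw [Finset.card_singleton] at this
  unfold clusterDist
  omega

/-- A clean split lowers the overclustering error. -/
theorem clusterDist_parts {U L R : Finset X} (hLR : Disjoint L R) (hL : (L ∩ U).Nonempty)
    (hR : (R ∩ U).Nonempty) (h : ∀ D ∈ target.parts, D ∩ U ⊆ L ∨ D ∩ U ⊆ R) :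
    clusterDist (L ∩ U) target.parts + clusterDist (R ∩ U) target.parts + 1 ≤
      clusterDist U target.parts := by
  -- Both counts are positive, so the truncated subtractions are exact and the parts lose 2 where
  -- the whole loses 1.
  have hpos : ∀ A : Finset X, A.Nonempty →
      0 < (target.parts.filter fun E => (E ∩ A).Nonempty).card := fun A hA => by
    obtain ⟨D, hD, h⟩ := exists_mem_target_inter_nonempty target hA
    exact Finset.card_pos.2 ⟨D, Finset.mem_filter.2 ⟨hD, h⟩⟩
  have h₁ := hpos _ hL
  have h₂ := hpos _ hR
  have h₃ : Disjoint (target.parts.filter fun E => (E ∩ (L ∩ U)).Nonempty)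
      (target.parts.filter fun E => (E ∩ (R ∩ U)).Nonempty) := by
    refine Finset.disjoint_left.2 fun D hD hD' => ?_
    obtain ⟨hD, hDL⟩ := Finset.mem_filter.1 hD
    obtain ⟨-, hDR⟩ := Finset.mem_filter.1 hD'
    rcases h D hD with h | h
    · exact not_nonempty_of_subset_disjoint hDR
        ((Finset.inter_subset_inter_left Finset.inter_subset_right).trans h)
        (Finset.inter_subset_right.trans Finset.inter_subset_left) hLR
    · exact not_nonempty_of_subset_disjoint hDL
        ((Finset.inter_subset_inter_left Finset.inter_subset_right).trans h)
        (Finset.inter_subset_right.trans Finset.inter_subset_left) hLR.symm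
  have h₄ : (target.parts.filter fun E => (E ∩ (L ∩ U)).Nonempty) ∪
      (target.parts.filter fun E => (E ∩ (R ∩ U)).Nonempty) ⊆
      target.parts.filter fun E => (E ∩ U).Nonempty := by
    intro D hD
    rw [Finset.mem_union, Finset.mem_filter, Finset.mem_filter] at hD
    rw [Finset.mem_filter]
    rcases hD with ⟨hD, h⟩ | ⟨hD, h⟩ <;>
      exact ⟨hD, h.mono (Finset.inter_subset_inter_left Finset.inter_subset_right)⟩
  have h₅ := Finset.card_le_card h₄
  rw [Finset.card_union_of_disjoint h₃] at h₅
  unfold clusterDist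
  omega

/-- The tree splits a set that is not within one target cluster cleanly. -/
theorem LinkageTree.Siblings.clean {U L R : Finset X} (hs : T.Siblings L R)
    (hc : ∀ N ∈ T.nodes, Compatible target.parts N) (hU : U ⊆ L ∪ R)
    (h : ∀ D ∈ target.parts, ¬ U ⊆ D) : ∀ D ∈ target.parts, D ∩ U ⊆ L ∨ D ∩ U ⊆ R := by
  intro D hD
  have hDU : D ∩ U ≤ L ⊔ R := Finset.inter_subset_right.trans hU
  -- Only `L` and `R` both inside `D` would obstruct the claim, and then `U` would lie in `D`.
  rcases hc L hs.left_mem D hD with h₁ | h₁ | h₁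
  · exact Or.inr ((h₁.symm.mono_left Finset.inter_subset_left).left_le_of_le_sup_left hDU)
  · rcases hc R hs.right_mem D hD with h₂ | h₂ | h₂
    · exact Or.inl ((h₂.symm.mono_left Finset.inter_subset_left).left_le_of_le_sup_right hDU)
    · exact (h D hD (hU.trans (Finset.union_subset h₁ h₂))).elim
    · exact Or.inr (Finset.inter_subset_left.trans h₂)
  · exact Or.inl (Finset.inter_subset_left.trans h₁)

/-! ### The effect of a single request -/

theorem sum_add_le_sum {α : Type*} {s : Finset α} {f g : α → ℕ} {a : α} {c : ℕ} (ha : a ∈ s)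
    (h : ∀ x ∈ s, f x ≤ g x) (hac : f a + c ≤ g a) : ∑ x ∈ s, f x + c ≤ ∑ x ∈ s, g x := by
  classical
  rw [← Finset.add_sum_erase s f ha, ← Finset.add_sum_erase s g ha]
  have := Finset.sum_le_sum fun x hx => h x (Finset.mem_of_mem_erase (s := s) (a := a) hx)
  omega

theorem edit_split (hT : T.Proper) (hcov : T.points = Finset.univ)
    (hc : ∀ N ∈ T.nodes, Compatible target.parts N) {P : Finset (Finset X)}
    (hP : IsClustering P) {C : Finset X} (hC : C ∈ feasibleSplits target.parts P) :
    IsClustering (edit T P (.split C)) ∧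
      overclusteringError (edit T P (.split C)) target.parts + 1 ≤
        overclusteringError P target.parts ∧
      totalPotential T target.parts (edit T P (.split C)) =
        totalPotential T target.parts P := by
  obtain ⟨hCP, h2⟩ := Finset.mem_filter.1 hC
  have hnot : ∀ D ∈ target.parts, ¬ C ⊆ D := by
    intro D hD h
    have := clusterDist_eq_zero hD h
    unfold clusterDist at this
    omega
  have hcard : 2 ≤ C.card := by
    by_contra h
    obtain ⟨x, hx⟩ := hP.nonempty C hCP
    obtain ⟨D, hD, hxD⟩ := target.exists_mem (Finset.mem_univ x)
    refine hnot D hD fun y hy => ?_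
    rw [Finset.card_le_one.1 (by omega) y hy x hx]
    exact hxD
  obtain ⟨L, R, hs, hU, hL, hR, hsplit⟩ :=
    LinkageTree.exists_split hT (hcov ▸ Finset.subset_univ C) hcard
  have hclean := hs.clean hc hU hnot
  have he : edit T P (.split C) = insert (L ∩ C) (insert (R ∩ C) (P.erase C)) := by
    rw [edit, hsplit, union_pair]
  have hd : ∀ E ∈ P.erase C, Disjoint C E := fun E hE =>
    hP.disjoint C hCP E (Finset.mem_of_mem_erase hE) (Finset.ne_of_mem_erase hE).symm
  rw [he]
  refine ⟨(hP.subset (Finset.erase_subset _ _)).insert_parts hd hs.disjoint hL hR, ?_, ?_⟩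
  · unfold overclusteringError clusteringDist
    rw [← Finset.add_sum_erase P _ hCP]
    have h₁ := sum_insert_le_add (fun A => clusterDist A target.parts) (L ∩ C)
      (insert (R ∩ C) (P.erase C))
    have h₂ := sum_insert_le_add (fun A => clusterDist A target.parts) (R ∩ C) (P.erase C)
    have h₃ := clusterDist_parts hs.disjoint hL hR hclean
    omega
  · refine Finset.sum_congr rfl fun D hD => ?_
    rw [pieces_insert_parts _ hs.disjoint (hclean D hD), Finset.insert_erase hCP]

theorem edit_merge (hT : T.Proper) (hcov : T.points = Finset.univ)
    (hc : ∀ N ∈ T.nodes, Compatible target.parts N) {P : Finset (Finset X)}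
    (hP : IsClustering P) {q : Finset (Finset X)} (hq : q ∈ feasibleMerges target.parts P) :
    IsClustering (edit T P (.merge q)) ∧
      overclusteringError (edit T P (.merge q)) target.parts ≤
        overclusteringError P target.parts ∧
      totalPotential T target.parts (edit T P (.merge q)) + 2 ≤
        totalPotential T target.parts P := by
  obtain ⟨⟨hqP, hq2⟩, D₀, hD₀, hqD⟩ := mem_feasibleMerges.1 hq
  obtain ⟨A, B, hne, rfl⟩ := Finset.card_eq_two.1 hq2
  have hAP : A ∈ P := hqP (by simp)
  have hBP : B ∈ P := hqP (by simp)
  have hAD := hqD A (by simp)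
  have hBD := hqD B (by simp)
  have hA := hP.nonempty A hAP
  have hB := hP.nonempty B hBP
  have hAB := hP.disjoint A hAP B hBP hne
  obtain ⟨Q, hQ⟩ : ∃ Q, Q = P \ {A, B} := ⟨_, rfl⟩
  have hPQ : P = insert A (insert B Q) := by
    rw [← union_pair, hQ, Finset.sdiff_union_of_subset hqP]
  have hQc : IsClustering Q := hP.subset (hQ ▸ Finset.sdiff_subset)
  have hAQ : ∀ C ∈ Q, Disjoint A C := fun C hC => by
    rw [hQ, Finset.mem_sdiff] at hC
    exact hP.disjoint A hAP C hC.1 fun h => hC.2 (by simp [h])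
  have hBQ : ∀ C ∈ Q, Disjoint B C := fun C hC => by
    rw [hQ, Finset.mem_sdiff] at hC
    exact hP.disjoint B hBP C hC.1 fun h => hC.2 (by simp [h])
  have hUQ : ∀ C ∈ Q, Disjoint (A ∪ B) C := fun C hC =>
    Finset.disjoint_union_left.2 ⟨hAQ C hC, hBQ C hC⟩
  have hBnQ : B ∉ Q := fun h => hB.ne_empty (disjoint_self.1 (hBQ B h))
  have hAnQ : A ∉ insert B Q := fun h => by
    rcases Finset.mem_insert.1 h with h | h
    · exact hne h
    · exact hA.ne_empty (disjoint_self.1 (hAQ A h))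
  have hover : overclusteringError P target.parts = clusterDist A target.parts +
      (clusterDist B target.parts + ∑ C ∈ Q, clusterDist C target.parts) := by
    rw [hPQ, overclusteringError, clusteringDist, Finset.sum_insert hAnQ,
      Finset.sum_insert hBnQ]
  have hdU := clusterDist_union_le hD₀ hAD hBD
  have hcard : 2 ≤ (A ∪ B).card := by
    rw [Finset.card_union_of_disjoint hAB]
    have := hA.card_pos
    have := hB.card_pos
    omega
  obtain ⟨L, R, hs, hU, hL, hR, hsplit⟩ :=
    LinkageTree.exists_split hT (hcov ▸ Finset.subset_univ (A ∪ B)) hcard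
  have hbi : ({A, B} : Finset (Finset X)).biUnion id = A ∪ B := by
    rw [Finset.biUnion_insert, Finset.singleton_biUnion, id, id]
  by_cases heq : ({L ∩ (A ∪ B), R ∩ (A ∪ B)} : Finset (Finset X)) = {A, B}
  · have he : edit T P (.merge {A, B}) = insert (A ∪ B) Q := by
      rw [edit, hbi, hsplit, if_pos heq, hQ, Finset.union_comm, Finset.singleton_union]
    rw [he]
    refine ⟨hQc.insert_disjoint (hA.mono Finset.subset_union_left) hUQ, ?_, ?_⟩
    · have := sum_insert_le_add (fun C => clusterDist C target.parts) (A ∪ B) Q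
      rw [hover, overclusteringError, clusteringDist]
      omega
    · rw [hPQ]
      exact sum_add_le_sum hD₀ (fun D _ => potential_pieces_union_le hAB hAQ hBQ)
        (potential_pieces_union_add_two_le hAB hAQ hBQ hAD hBD)
  · have he : edit T P (.merge {A, B}) =
        insert (L ∩ (A ∪ B)) (insert (R ∩ (A ∪ B)) Q) := by
      rw [edit, hbi, hsplit, if_neg heq, union_pair, hQ]
    have h₁ := sum_insert_le_add (fun C => clusterDist C target.parts) (L ∩ (A ∪ B))
      (insert (R ∩ (A ∪ B)) Q)
    have h₂ := sum_insert_le_add (fun C => clusterDist C target.parts) (R ∩ (A ∪ B)) Q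
    rw [he]
    refine ⟨hQc.insert_parts hUQ hs.disjoint hL hR, ?_, ?_⟩
    · rw [hover, overclusteringError, clusteringDist]
      -- Inside one target cluster both parts have distance zero; otherwise the split is clean and
      -- regains more than uniting cost.
      by_cases hpure : ∃ D ∈ target.parts, A ∪ B ⊆ D
      · obtain ⟨D, hD, hUD⟩ := hpure
        have := clusterDist_eq_zero hD ((Finset.inter_subset_right (s₁ := L)).trans hUD)
        have := clusterDist_eq_zero hD ((Finset.inter_subset_right (s₁ := R)).trans hUD)
        omega
      · push Not at hpure
        have := clusterDist_parts hs.disjoint hL hR (hs.clean hc hU hpure)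
        omega
    · rw [hPQ]
      by_cases hpure : ∃ D ∈ target.parts, A ∪ B ⊆ D
      · obtain ⟨D, hD, hUD⟩ := hpure
        have hAD' := Finset.subset_union_left.trans hUD
        have hBD' := Finset.subset_union_right.trans hUD
        have hLD := (Finset.inter_subset_right (s₁ := L)).trans hUD
        have hRD := (Finset.inter_subset_right (s₁ := R)).trans hUD
        have hstrict : potential T (pieces D (insert (L ∩ (A ∪ B)) (insert (R ∩ (A ∪ B)) Q)))
            + 2 ≤ potential T (pieces D (insert A (insert B Q))) := by
          have e : ∀ {E : Finset X} (Q : Finset (Finset X)), E.Nonempty → E ⊆ D →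
              pieces D (insert E Q) = insert E (pieces D Q) := fun {E} Q hE hED => by
            have : E ∩ D = E := Finset.inter_eq_left.2 hED
            rw [pieces_insert_of_nonempty _ (this.symm ▸ hE), this]
          rw [e _ hL hLD, e _ hR hRD, e _ hA hAD', e _ hB hBD']
          exact potential_split_add_two_le hT (notMem_pieces_of_disjoint hA hAQ)
            (notMem_pieces_of_disjoint hB hBQ) hne hA hB
            -- Had `A` and `B` been separated, the split would have returned them.
            (fun h => heq (h.pair_eq hT hA hB hs hU hL hR)) hs hU
        refine sum_add_le_sum hD (fun D' hD' => ?_) hstrict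
        by_cases hDD : D' = D
        · subst hDD
          exact (Nat.le_add_right _ _).trans hstrict
        · have e : ∀ {E : Finset X} (Q : Finset (Finset X)), E ⊆ D →
              pieces D' (insert E Q) = pieces D' Q := fun {E} Q hED => by
            refine pieces_insert_of_eq_empty _ (Finset.disjoint_iff_inter_eq_empty.1 ?_)
            exact (target.disjoint hD hD' (Ne.symm hDD)).mono_left hED
          rw [e _ hLD, e _ hRD, e _ hAD', e _ hBD']
      · push Not at hpure
        -- A clean split yields the same pieces as `A ∪ B` itself, so this case reduces to uniting.
        have hclean := hs.clean hc hU hpure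
        refine sum_add_le_sum hD₀ (fun D hD => ?_) ?_
        · rw [pieces_insert_parts _ hs.disjoint (hclean D hD)]
          exact potential_pieces_union_le hAB hAQ hBQ
        · rw [pieces_insert_parts _ hs.disjoint (hclean D₀ hD₀)]
          exact potential_pieces_union_add_two_le hAB hAQ hBQ hAD hBD

/-- The requests in a valid history are paid for by the overclustering error and the potential. -/
theorem ValidHistory.bounds (hT : T.Proper) (hcov : T.points = Finset.univ)
    (hc : ∀ N ∈ T.nodes, Compatible target.parts N) {P : Finset (Finset X)}
    (hP : IsClustering P) {h : List (Request X)} (hv : ValidHistory T target.parts P h) :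
    IsClustering (current T P h) ∧
      splitCount h + overclusteringError (current T P h) target.parts ≤
        overclusteringError P target.parts ∧
      2 * mergeCount h + totalPotential T target.parts (current T P h) ≤
        totalPotential T target.parts P := by
  induction h with
  | nil => exact ⟨hP, by simp [splitCount, current], by simp [mergeCount, current]⟩
  | cons r h ih =>
    obtain ⟨hv, -, hr⟩ := hv
    obtain ⟨h₁, h₂, h₃⟩ := ih hv
    cases r with
    | split C =>
      obtain ⟨e₁, e₂, e₃⟩ := edit_split hT hcov hc h₁ hr
      refine ⟨e₁, ?_, ?_⟩
      · simp only [splitCount, current]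
        omega
      · simp only [mergeCount, current]
        omega
    | merge q =>
      obtain ⟨e₁, e₂, e₃⟩ := edit_merge hT hcov hc h₁ hr
      refine ⟨e₁, ?_, ?_⟩
      · simp only [splitCount, current]
        omega
      · simp only [mergeCount, current]
        omega

/-! ### From valid histories to the random process -/

theorem splitCount_add_mergeCount {Y : Type*} (h : List (Request Y)) :
    splitCount h + mergeCount h = h.length := by
  induction h with
  | nil => rfl
  | cons r h ih =>
    cases r <;> simp only [splitCount, mergeCount, List.length_cons] <;> omega

/-- The length alternative lets a bound on the number of requests force arrival at the target. -/
theorem history_support {P : Finset (Finset X)} {oracle : List (Request X) → PMF (Request X)}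
    (ho : IsRandomMergeOracle T target.parts P oracle) (n : ℕ) :
    ∀ h ∈ (history T target.parts P oracle n).support, ValidHistory T target.parts P h ∧
      (current T P h = target.parts ∨ h.length = n) := by
  induction n with
  | zero =>
    intro h hh
    rw [history, PMF.support_pure, Set.mem_singleton_iff] at hh
    subst hh
    exact ⟨trivial, Or.inr rfl⟩
  | succ n ih =>
    intro h hh
    rw [history, PMF.mem_support_bind_iff] at hh
    obtain ⟨g, hg, hh⟩ := hh
    obtain ⟨hv, hg⟩ := ih g hg
    by_cases hcur : current T P g = target.parts
    · rw [if_pos hcur, PMF.support_pure, Set.mem_singleton_iff] at hh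
      subst hh
      exact ⟨hv, Or.inl hcur⟩
    · rw [if_neg hcur, PMF.mem_support_map_iff] at hh
      obtain ⟨r, hr, rfl⟩ := hh
      refine ⟨⟨hv, hcur, (ho g hv hcur).1 r hr⟩, Or.inr ?_⟩
      rw [List.length_cons, hg.resolve_left hcur]

theorem Finpartition.isClustering (P : Finpartition (Finset.univ : Finset X)) :
    IsClustering P.parts :=
  ⟨fun _ hC => P.nonempty_of_mem_parts hC, fun _ hC _ hD h => P.disjoint hC hD h⟩

/-- For a stable target, every valid history contains at most `δₒ` split requests and at most
`2 δᵤ²` merge requests. -/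
theorem ValidHistory.count_le {S : X → X → ℝ} (hsymm : ∀ x y, S x y = S y x)
    (hS : Stable S target.parts) (hT : IsAverageLinkageTree S T)
    {initial : Finpartition (Finset.univ : Finset X)} {h : List (Request X)}
    (hv : ValidHistory T target.parts initial.parts h) :
    splitCount h ≤ overclusteringError initial.parts target.parts ∧
      mergeCount h ≤ 2 * underclusteringError initial.parts target.parts ^ 2 := by
  have hF := hT.compatibleForest hsymm hS
  have hcov : T.points = Finset.univ := by
    refine Finset.eq_univ_iff_forall.2 fun x => ?_
    obtain ⟨a, rfl, hx⟩ := hF.cover x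
    exact hx
  obtain ⟨-, h₁, h₂⟩ := hv.bounds (hF.proper T rfl) hcov (hF.compatible T rfl)
    (Finpartition.isClustering initial)
  have := totalPotential_le T target.parts initial.parts
  omega

end Dynamics

end InteractiveClustering

open InteractiveClustering

theorem theorem5 :
    ∃ K : ℝ, 0 < K ∧
      ∀ (X : Type*) [Fintype X] [DecidableEq X] (S : X → X → ℝ)
        (target initial : Finpartition (Finset.univ : Finset X))
        (T : LinkageTree X) (oracle : List (Request X) → PMF (Request X)) (ε : ℝ),
        (∀ x y, S x y = S y x) →
        Stable S target.parts →
        IsAverageLinkageTree S T →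
        IsRandomMergeOracle T target.parts initial.parts oracle →
        0 < ε → ε < 1 → 2 ≤ (target.parts.card : ℝ) / ε →
        ∀ n : ℕ,
          (overclusteringError initial.parts target.parts : ℝ) +
            K * Real.log ((target.parts.card : ℝ) / ε) *
              (underclusteringError initial.parts target.parts : ℝ) ^ 2 ≤ (n : ℝ) →
          1 - ε ≤ ((history T target.parts initial.parts oracle n).toOuterMeasure
            {h | current T initial.parts h = target.parts ∧
              splitCount h ≤ overclusteringError initial.parts target.parts ∧
              (mergeCount h : ℝ) ≤ K * Real.log ((target.parts.card : ℝ) / ε) *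
                (underclusteringError initial.parts target.parts : ℝ) ^ 2}).toReal := by
  refine ⟨3, by norm_num, ?_⟩
  intro X _ _ S target initial T oracle ε hsymm hS hT ho hε _ hk n hn
  -- This fixes the constant: `3 log 2 > 2`, the factor in the bound on merges.
  have hlog : 2 ≤ 3 * Real.log ((target.parts.card : ℝ) / ε) := by
    have := Real.log_le_log (by norm_num) hk
    have := Real.log_two_gt_d9
    linarith
  have hmul := mul_le_mul_of_nonneg_right hlog
    (sq_nonneg (underclusteringError initial.parts target.parts : ℝ))
  have hone : (history T target.parts initial.parts oracle n).toOuterMeasure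
      {h | current T initial.parts h = target.parts ∧
        splitCount h ≤ overclusteringError initial.parts target.parts ∧
        (mergeCount h : ℝ) ≤ 3 * Real.log ((target.parts.card : ℝ) / ε) *
          (underclusteringError initial.parts target.parts : ℝ) ^ 2} = 1 := by
    rw [PMF.toOuterMeasure_apply_eq_one_iff]
    intro h hh
    obtain ⟨hv, hcur⟩ := history_support ho n h hh
    obtain ⟨h₁, h₂⟩ := hv.count_le hsymm hS hT
    have h₂' : (mergeCount h : ℝ) ≤
        2 * (underclusteringError initial.parts target.parts : ℝ) ^ 2 := by exact_mod_cast h₂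
    refine ⟨?_, h₁, h₂'.trans hmul⟩
    by_contra hne
    -- If the target is not reached, one further request gives a valid history of length `n + 1`.
    -- This extra request is needed since `n` may equal the bound.
    obtain ⟨r, hr⟩ := (oracle h).support_nonempty
    have hv' : ValidHistory T target.parts initial.parts (r :: h) :=
      ⟨hv, hne, (ho h hv hne).1 r hr⟩
    obtain ⟨g₁, g₂⟩ := hv'.count_le hsymm hS hT
    have hlen := splitCount_add_mergeCount (r :: h)
    rw [List.length_cons, hcur.resolve_left hne] at hlen
    have hle : n + 1 ≤ overclusteringError initial.parts target.parts +
        2 * underclusteringError initial.parts target.parts ^ 2 := by omega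
    have hle' : (n : ℝ) + 1 ≤ (overclusteringError initial.parts target.parts : ℝ) +
        2 * (underclusteringError initial.parts target.parts : ℝ) ^ 2 := by exact_mod_cast hle
    linarith
  rw [hone, ENNReal.toReal_one]
  linarith
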